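/- Let $K$ be a field, $R=K[\![x,y,z]\!]$, and let $R$ act on the polynomials in $X,Y,Z$ over $K$ by contraction: $x^ay^bz^c\circ X^iY^jZ^k=X^{i-a}Y^{j-b}Z^{k-c}$ if $a\le i$, $b\le j$, $c\le k$, and $0$ otherwise, extended $K$-linearly. For a polynomial $F$ let $\operatorname{ann}_R(F)=\{f\in R: f\circ F=0\}$. An ideal of $R$ (or the quotient by it) is called a complete intersection if the ideal is generated by a regular sequence. The Hilbert function of $A=R/I$ with maximal ideal $\mathfrak m$ is $t\mapsto\dim_K \mathfrak m^t/\mathfrak m^{t+1}$. For integers $u,v,w\ge 0$ let $$h=(1,3,3,\underbrace{3,\ldots,3}_u,\underbrace{2,\ldots,2}_v,\underbrace{1,\ldots,1}_w,1),$$ continued by zeros (every such sequence is an O-sequence, that is, satisfies Macaulay's bound). Then there are $f,g,p\in R$ such that $R/(f,g,p)$ is an Artinian complete intersection with Hilbert function $h$. More precisely: (1) If $u=v=w=0$, then $\operatorname{ann}_R(XYZ)=(x^2,y^2,z^2)$, this ideal is a complete intersection, and $R/\operatorname{ann}_R(XYZ)$ is Artinian with Hilbert function $h=(1,3,3,1)$.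 (2) If at least one of $u,v,w$ is nonzero, then for $F=X^{u+v+w+3}+Y^{u+v+3}+Z^{u+3}+XYZ$ one has $$\operatorname{ann}_R(F)=\left(yz-x^{u+v+w+2},\; xz-y^{u+v+2},\; xy-z^{u+2}\right),$$ this ideal is a complete intersection, and $R/\operatorname{ann}_R(F)$ is Artinian with Hilbert function $h$. -/

import Mathlib

open Finset.HasAntidiagonal in
/-- The contraction action of a power series `f` on polynomials: the `K`-linear map with
`X^n ↦ ∑_{a + b = n} (coeff_a f) X^b`; so `x^a ∘ X^n = X^(n - a)` if `a ≤ n`, and `0` otherwise. -/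
noncomputable def contraction {m : ℕ} {K : Type*} [Field K] (f : MvPowerSeries (Fin m) K) :
    MvPolynomial (Fin m) K →ₗ[K] MvPolynomial (Fin m) K :=
  (MvPolynomial.basisMonomials (Fin m) K).constr K fun n =>
    ∑ p ∈ antidiagonal n, MvPolynomial.monomial p.2 (MvPowerSeries.coeff p.1 f)

open Finset.HasAntidiagonal in
theorem contraction_monomial {m : ℕ} {K : Type*} [Field K] (f : MvPowerSeries (Fin m) K)
    (n : Fin m →₀ ℕ) (c : K) :
    contraction f (MvPolynomial.monomial n c) =
      ∑ p ∈ antidiagonal n, MvPolynomial.monomial p.2 (MvPowerSeries.coeff p.1 f * c) := by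
  have h : MvPolynomial.monomial n c =
      c • (MvPolynomial.basisMonomials (Fin m) K) n := by
    simp [MvPolynomial.smul_monomial]
  rw [h, map_smul, contraction, Module.Basis.constr_basis, Finset.smul_sum]
  simp [MvPolynomial.smul_monomial, mul_comm]

/-- Defining formula of the contraction action on monomials. -/
theorem contraction_monomial_monomial {m : ℕ} {K : Type*} [Field K] (a n : Fin m →₀ ℕ) :
    contraction (MvPowerSeries.monomial a (1 : K)) (MvPolynomial.monomial n 1) =
      if a ≤ n then MvPolynomial.monomial (n - a) 1 else 0 := by
  classical
  rw [contraction_monomial]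
  split_ifs with h
  · rw [Finset.sum_eq_single (a, n - a)]
    · simp
    · rintro ⟨b, c⟩ hb hne
      rw [Finset.HasAntidiagonal.mem_antidiagonal] at hb
      have hba : b ≠ a := by
        rintro rfl
        apply hne
        simp only at hb
        rw [← hb, add_tsub_cancel_left]
      simp [MvPowerSeries.coeff_monomial, hba]
    · intro h'
      exact absurd (Finset.HasAntidiagonal.mem_antidiagonal.2 (add_tsub_cancel_of_le h)) h'
  · refine Finset.sum_eq_zero ?_
    rintro ⟨b, c⟩ hb
    rw [Finset.HasAntidiagonal.mem_antidiagonal] at hb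
    have hba : b ≠ a := by
      rintro rfl
      exact h (hb ▸ le_self_add)
    simp [MvPowerSeries.coeff_monomial, hba]

theorem contraction_one {m : ℕ} {K : Type*} [Field K] (F : MvPolynomial (Fin m) K) :
    contraction (1 : MvPowerSeries (Fin m) K) F = F := by
  have h : contraction (1 : MvPowerSeries (Fin m) K) = LinearMap.id := by
    refine (MvPolynomial.basisMonomials (Fin m) K).ext fun n => ?_
    have := contraction_monomial_monomial (K := K) (0 : Fin m →₀ ℕ) n
    simpa using this
  rw [h, LinearMap.id_apply]

theorem contraction_mul {m : ℕ} {K : Type*} [Field K] (f g : MvPowerSeries (Fin m) K)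
    (F : MvPolynomial (Fin m) K) :
    contraction (f * g) F = contraction f (contraction g F) := by
  classical
  have h : contraction (f * g) = contraction f ∘ₗ contraction g := by
    refine (MvPolynomial.basisMonomials (Fin m) K).ext fun n => ?_
    simp only [MvPolynomial.coe_basisMonomials, LinearMap.comp_apply, contraction_monomial,
      map_sum, mul_one]
    simp only [MvPowerSeries.coeff_mul, map_sum]
    rw [Finset.sum_sigma', Finset.sum_sigma']
    refine Finset.sum_nbij' (fun x => ⟨(x.2.2, x.2.1 + x.1.2), (x.2.1, x.1.2)⟩)
      (fun x => ⟨(x.2.1 + x.1.1, x.2.2), (x.2.1, x.1.1)⟩) ?_ ?_ ?_ ?_ ?_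
    · rintro ⟨⟨a, b⟩, ⟨c, d⟩⟩ hx
      simp only [Finset.mem_sigma, Finset.HasAntidiagonal.mem_antidiagonal] at hx ⊢
      obtain ⟨rfl, rfl⟩ := hx
      simp [add_left_comm, add_comm]
    · rintro ⟨⟨a, b⟩, ⟨c, d⟩⟩ hx
      simp only [Finset.mem_sigma, Finset.HasAntidiagonal.mem_antidiagonal] at hx ⊢
      obtain ⟨rfl, rfl⟩ := hx
      simp [add_left_comm, add_comm]
    · rintro ⟨⟨a, b⟩, ⟨c, d⟩⟩ hx
      simp only [Finset.mem_sigma, Finset.HasAntidiagonal.mem_antidiagonal] at hx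
      obtain ⟨rfl, rfl⟩ := hx
      rfl
    · rintro ⟨⟨a, b⟩, ⟨c, d⟩⟩ hx
      simp only [Finset.mem_sigma, Finset.HasAntidiagonal.mem_antidiagonal] at hx
      obtain ⟨rfl, rfl⟩ := hx
      rfl
    · rintro ⟨⟨a, b⟩, ⟨c, d⟩⟩ hx
      simp
  rw [h, LinearMap.comp_apply]

theorem contraction_add {m : ℕ} {K : Type*} [Field K] (f g : MvPowerSeries (Fin m) K)
    (F : MvPolynomial (Fin m) K) :
    contraction (f + g) F = contraction f F + contraction g F := by
  have h : contraction (f + g) = contraction f + contraction g := by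
    refine (MvPolynomial.basisMonomials (Fin m) K).ext fun n => ?_
    simp [contraction_monomial, Finset.sum_add_distrib]
  rw [h, LinearMap.add_apply]

/-- Polynomials in `X_1, …, X_m` as a module over power series in `x_1, …, x_m`,
through contraction. -/
noncomputable instance contractionModule {m : ℕ} {K : Type*} [Field K] :
    Module (MvPowerSeries (Fin m) K) (MvPolynomial (Fin m) K) where
  smul f F := contraction f F
  one_smul := contraction_one
  mul_smul := contraction_mul
  smul_zero f := map_zero (contraction f)
  smul_add f := map_add (contraction f)
  add_smul := contraction_add
  zero_smul F := by
    have h := contraction_add (0 : MvPowerSeries (Fin m) K) 0 F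
    rw [add_zero] at h
    exact left_eq_add.mp h

/-- `ann_R(F)`: the annihilator in `R = K⟦x_1, …, x_m⟧` of the `R`-submodule `⟨F⟩` generated
by `F` under contraction. -/
noncomputable def apolarIdeal {m : ℕ} {K : Type*} [Field K] (F : MvPolynomial (Fin m) K) :
    Ideal (MvPowerSeries (Fin m) K) :=
  (Submodule.span (MvPowerSeries (Fin m) K) {F}).annihilator

/-- The Hilbert function `t ↦ dim_K 𝔪^t / 𝔪^(t+1)` of `A = R / I`, where
`R = K⟦x_1, …, x_m⟧` and `𝔪 = (x_1, …, x_m) / I`. These dimensions are finite. -/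
noncomputable def hilbertFunction {m : ℕ} {K : Type*} [Field K]
    (I : Ideal (MvPowerSeries (Fin m) K)) (t : ℕ) : ℕ :=
  let 𝔪 : Ideal (MvPowerSeries (Fin m) K ⧸ I) :=
    (IsLocalRing.maximalIdeal (MvPowerSeries (Fin m) K)).map (Ideal.Quotient.mk I)
  Module.finrank K (↥(𝔪 ^ t) ⧸ (𝔪 ^ (t + 1)).submoduleOf (𝔪 ^ t))

/-- `I` (or `R / I`) is a complete intersection: `I` is generated by a regular sequence. -/
def IsCompleteIntersection {m : ℕ} {K : Type*} [Field K]
    (I : Ideal (MvPowerSeries (Fin m) K)) : Prop :=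
  ∃ rs : List (MvPowerSeries (Fin m) K),
    RingTheory.Sequence.IsRegular (MvPowerSeries (Fin m) K) rs ∧ Ideal.ofList rs = I

/-- The sequence `(1, 3, 3, 3^u, 2^v, 1^w, 1)`, continued by zeros. -/
def hSequence (u v w : ℕ) (t : ℕ) : ℕ :=
  ([1, 3, 3] ++ List.replicate u 3 ++ List.replicate v 2 ++ List.replicate w 1 ++ [1]).getD t 0

/-!
The annihilator, the Artinian property and the Hilbert function all come from an explicit monomial
basis of `R / I`, where `I` is the ideal of three generators. A finite set `S` of exponents is used
with two properties.

* Every monomial `x ^ n` is, modulo `I`, a linear combination of monomials `x ^ s` with `s ∈ S` of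
  degree at least that of `n`. Then the images of the `x ^ s` with `s ∈ S` of degree at least `t`
  span `𝔪 ^ t` (`map_maximalIdeal_pow_eq_span`).
* Every `s ∈ S` has a dual exponent `d s` such that the coefficient of `F` at `s' + d s` is `1` for
  `s' = s` and `0` for the other `s' ∈ S`. Then the monomials with exponents in `S` are linearly
  independent modulo `ann F`.

As `I ≤ ann F`, both together give `I = ann F` and show that the Hilbert function at `t` counts the
members of `S` of degree `t` (`apolarIdeal_eq_of_monomial_span`, `hilbertFunction_eq_card`).

For `X Y Z` the set `S` consists of the squarefree exponents. In the other case put `P = u + v + w`,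
`Q = u + v`, `R = u`. The relations `y z = x ^ (P + 2)`, `x z = y ^ (Q + 2)`, `x y = z ^ (R + 2)`
imply `x ^ 2 y = x ^ 2 y * (x ^ P y ^ Q z ^ R)`, hence `x ^ 2 y = 0` since `P > 0`, and similarly
for the other such products (`sq_mul_eq_zero_of_relations`). So only powers of a single variable
survive, with `x ^ (P + 3) = y ^ (Q + 3) = z ^ (R + 3) = x y z` and `x ^ (P + 4) = 0`
(`monomial_mem_span_axisExponents`).

For the complete intersection property no dimension theory is needed. A regular sequence in a
Noetherian local ring may be permuted, and its last member may be replaced by a divisor of it modulo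
the others (`IsWeaklyRegular.replace_last`). Starting from powers of `x`, `y`, `z`, this leads to the
three generators, because `z ^ (r N)` is a multiple of `x y - z ^ r` modulo `x ^ N`, because
`y ^ (q N)` is a multiple of `x z - y ^ q` modulo `x ^ N`, and because `x ^ N` lies in the ideal
(`isCompleteIntersection_of_X_pow_mem`).
-/

/-! ### Ideals of power series generated by variables -/

theorem MvPowerSeries.coeff_eq_zero_of_mem_span_X {σ K : Type*} [CommRing K] {s : Set σ}
    {f : MvPowerSeries σ K} (hf : f ∈ Ideal.span (MvPowerSeries.X (R := K) '' s))
    {n : σ →₀ ℕ} (hn : ∀ i ∈ s, n i = 0) : MvPowerSeries.coeff n f = 0 := by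
  classical
  induction hf using Submodule.span_induction generalizing n with
  | mem x hx =>
    obtain ⟨i, hi, rfl⟩ := hx
    exact MvPowerSeries.X_dvd_iff.1 dvd_rfl n (hn i hi)
  | zero => simp
  | add x y _ _ hx hy => rw [map_add, hx hn, hy hn, add_zero]
  | smul a x _ hx =>
    rw [smul_eq_mul, MvPowerSeries.coeff_mul]
    refine Finset.sum_eq_zero fun p hp => ?_
    rw [Finset.HasAntidiagonal.mem_antidiagonal] at hp
    rw [hx fun i hi => ?_, mul_zero]
    have := hn i hi
    rw [← hp, Finsupp.add_apply] at this
    omega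

/-- Membership in the ideal generated by finitely many variables is read off the coefficients:
the terms of `f` divisible by one of the variables can be split off, one variable at a time. -/
theorem MvPowerSeries.mem_span_X_iff {σ K : Type*} [CommRing K] (s : Finset σ)
    (f : MvPowerSeries σ K) :
    f ∈ Ideal.span (MvPowerSeries.X (R := K) '' (s : Set σ)) ↔
      ∀ n : σ →₀ ℕ, (∀ i ∈ s, n i = 0) → MvPowerSeries.coeff n f = 0 := by
  classical
  refine ⟨fun hf n hn => coeff_eq_zero_of_mem_span_X hf hn, ?_⟩
  induction s using Finset.induction_on generalizing f with
  | empty =>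
    intro h
    have : f = 0 := MvPowerSeries.ext fun n => h n (by simp)
    rw [this]
    exact zero_mem _
  | insert i s _ ih =>
    intro h
    let g : MvPowerSeries σ K := fun n => if n i = 0 then MvPowerSeries.coeff n f else 0
    have hg : ∀ n, MvPowerSeries.coeff n g = if n i = 0 then MvPowerSeries.coeff n f else 0 :=
      fun n => rfl
    have h1 : MvPowerSeries.X i ∣ f - g := MvPowerSeries.X_dvd_iff.2 fun n hn => by
      rw [map_sub, hg, if_pos hn, sub_self]
    have h2 : g ∈ Ideal.span (MvPowerSeries.X (R := K) '' (s : Set σ)) := by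
      refine ih g fun n hn => ?_
      rw [hg]
      split_ifs with hi
      · refine h n fun j hj => ?_
        rcases Finset.mem_insert.1 hj with rfl | hj
        exacts [hi, hn j hj]
      · rfl
    rw [← sub_add_cancel f g]
    refine add_mem (Ideal.mem_of_dvd _ h1 (Ideal.subset_span ⟨i, by simp, rfl⟩)) ?_
    exact Ideal.span_mono (Set.image_mono (by simp)) h2

theorem MvPowerSeries.mem_maximalIdeal_iff {σ K : Type*} [Field K] (f : MvPowerSeries σ K) :
    f ∈ IsLocalRing.maximalIdeal (MvPowerSeries σ K) ↔ MvPowerSeries.constantCoeff f = 0 := by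
  rw [IsLocalRing.mem_maximalIdeal, mem_nonunits_iff, MvPowerSeries.isUnit_iff_constantCoeff,
    isUnit_iff_ne_zero, not_not]

theorem MvPowerSeries.maximalIdeal_eq_span_X {σ K : Type*} [Fintype σ] [Field K] :
    IsLocalRing.maximalIdeal (MvPowerSeries σ K) =
      Ideal.span (Set.range (MvPowerSeries.X (R := K))) := by
  ext f
  have h := mem_span_X_iff Finset.univ f
  rw [Finset.coe_univ, Set.image_univ] at h
  rw [h, mem_maximalIdeal_iff]
  refine ⟨fun hf n hn => ?_, fun hf => hf 0 (by simp)⟩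
  obtain rfl : n = 0 := Finsupp.ext fun i => hn i (Finset.mem_univ i)
  exact hf

theorem MvPowerSeries.maximalIdeal_pow_eq_span_monomial {σ K : Type*} [Fintype σ] [Field K]
    (t : ℕ) : IsLocalRing.maximalIdeal (MvPowerSeries σ K) ^ t =
      Ideal.span ((MvPowerSeries.monomial · (1 : K)) '' {n : σ →₀ ℕ | n.degree = t}) := by
  have h : IsLocalRing.maximalIdeal (MvPowerSeries σ K) =
      (MvPolynomial.idealOfVars σ K).map (MvPolynomial.coeToMvPowerSeries.ringHom (R := K)) := by
    rw [maximalIdeal_eq_span_X, MvPolynomial.idealOfVars, Ideal.map_span, ← Set.range_comp]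
    congr 2
    ext1 i
    simp
  rw [h, ← Ideal.map_pow, MvPolynomial.pow_idealOfVars_eq_span, Ideal.map_span, Set.image_image]
  congr 1
  refine Set.image_congr fun n _ => ?_
  simp

theorem MvPowerSeries.monomial_mem_maximalIdeal_pow {σ K : Type*} [Fintype σ] [Field K]
    {n : σ →₀ ℕ} {t : ℕ} (h : t ≤ n.degree) :
    MvPowerSeries.monomial n (1 : K) ∈ IsLocalRing.maximalIdeal (MvPowerSeries σ K) ^ t := by
  refine Ideal.pow_le_pow_right h ?_
  rw [maximalIdeal_pow_eq_span_monomial]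
  exact Ideal.subset_span ⟨n, rfl, rfl⟩

/-- Modulo `𝔪 ^ (t + 1)`, an element of `𝔪 ^ t` is a linear combination of the monomials of
degree `t`. -/
theorem MvPowerSeries.maximalIdeal_pow_le {σ K : Type*} [Fintype σ] [Field K] (t : ℕ) :
    (IsLocalRing.maximalIdeal (MvPowerSeries σ K) ^ t).restrictScalars K ≤
      Submodule.span K ((MvPowerSeries.monomial · (1 : K)) '' {n : σ →₀ ℕ | n.degree = t}) ⊔
      (IsLocalRing.maximalIdeal (MvPowerSeries σ K) ^ (t + 1)).restrictScalars K := by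
  intro f hf
  rw [Submodule.restrictScalars_mem, maximalIdeal_pow_eq_span_monomial] at hf
  induction hf using Submodule.closure_induction with
  | zero => exact zero_mem _
  | add x y _ _ hx hy => exact add_mem hx hy
  | smul_mem a x hx =>
    obtain ⟨n, hn, rfl⟩ := hx
    have h1 : a - C (constantCoeff a) ∈ IsLocalRing.maximalIdeal (MvPowerSeries σ K) := by
      rw [mem_maximalIdeal_iff, map_sub, constantCoeff_C, sub_self]
    have h2 : a • MvPowerSeries.monomial n (1 : K) =
        constantCoeff a • MvPowerSeries.monomial n (1 : K) +
          (a - C (constantCoeff a)) * MvPowerSeries.monomial n (1 : K) := by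
      rw [smul_eq_C_mul, smul_eq_mul]
      ring
    simp only
    rw [h2]
    refine Submodule.add_mem_sup (Submodule.smul_mem _ _ (Submodule.subset_span ⟨n, hn, rfl⟩)) ?_
    rw [Submodule.restrictScalars_mem, pow_succ']
    exact Ideal.mul_mem_mul h1 (monomial_mem_maximalIdeal_pow (le_of_eq hn.symm))

/-! ### Hilbert functions from monomial bases -/

/-- The hypothesis `hspan` says that the monomials with exponents in `S` span `A = R / I`, and that
rewriting a monomial in terms of them does not lower its degree. -/
theorem map_maximalIdeal_pow_eq_span {m : ℕ} {K : Type*} [Field K]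
    {I : Ideal (MvPowerSeries (Fin m) K)} {S : Finset (Fin m →₀ ℕ)}
    (hspan : ∀ n : Fin m →₀ ℕ, Ideal.Quotient.mk I (MvPowerSeries.monomial n 1) ∈
      Submodule.span K ((fun s => Ideal.Quotient.mk I (MvPowerSeries.monomial s 1)) ''
        {s | s ∈ S ∧ n.degree ≤ s.degree})) (t : ℕ) :
    (((IsLocalRing.maximalIdeal (MvPowerSeries (Fin m) K)).map (Ideal.Quotient.mk I)) ^
        t).restrictScalars K =
      Submodule.span K ((fun s => Ideal.Quotient.mk I (MvPowerSeries.monomial s 1)) ''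
        {s | s ∈ S ∧ t ≤ s.degree}) := by
  set 𝔪 := (IsLocalRing.maximalIdeal (MvPowerSeries (Fin m) K)).map (Ideal.Quotient.mk I)
  set e : (Fin m →₀ ℕ) → MvPowerSeries (Fin m) K ⧸ I :=
    fun s => Ideal.Quotient.mk I (MvPowerSeries.monomial s 1)
  set W : ℕ → Submodule K (MvPowerSeries (Fin m) K ⧸ I) :=
    fun t => Submodule.span K (e '' {s | s ∈ S ∧ t ≤ s.degree})
  have hW : ∀ {t t'}, t ≤ t' → W t' ≤ W t := fun h =>
    Submodule.span_mono (Set.image_mono fun s hs => ⟨hs.1, h.trans hs.2⟩)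
  obtain ⟨T, hT⟩ : ∃ T, ∀ s ∈ S, s.degree < T :=
    ⟨S.sup Finsupp.degree + 1, fun s hs => Nat.lt_succ_of_le (Finset.le_sup hs)⟩
  have hWT : ∀ t, T ≤ t → W t = ⊥ := fun t ht => by
    rw [Submodule.span_eq_bot]
    rintro _ ⟨s, ⟨hs, hs'⟩, rfl⟩
    have := hT s hs
    omega
  have hstep : ∀ t, (𝔪 ^ t).restrictScalars K ≤ W t ⊔ (𝔪 ^ (t + 1)).restrictScalars K := by
    intro t x hx
    rw [Submodule.restrictScalars_mem, ← Ideal.map_pow,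
      Ideal.mem_map_iff_of_surjective _ Ideal.Quotient.mk_surjective] at hx
    obtain ⟨f, hf, rfl⟩ := hx
    obtain ⟨g, hg, h, hh, rfl⟩ := Submodule.mem_sup.1 (MvPowerSeries.maximalIdeal_pow_le t hf)
    rw [map_add]
    refine Submodule.add_mem_sup ?_ ?_
    · have := Submodule.mem_map_of_mem (f := (Ideal.Quotient.mkₐ K I).toLinearMap) hg
      rw [Submodule.map_span, Set.image_image] at this
      refine (Submodule.span_le.2 ?_) this
      rintro _ ⟨n, hn, rfl⟩
      exact hW (le_of_eq hn.symm) (hspan n)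
    · rw [Submodule.restrictScalars_mem, ← Ideal.map_pow]
      exact Ideal.mem_map_of_mem _ hh
  have hzero : 𝔪 ^ T = ⊥ := by
    rw [← Ideal.map_pow, MvPowerSeries.maximalIdeal_pow_eq_span_monomial, Ideal.map_span,
      Ideal.span_eq_bot]
    rintro _ ⟨_, ⟨n, hn, rfl⟩, rfl⟩
    have := hspan n
    change _ ∈ W n.degree at this
    rwa [hWT _ (le_of_eq hn.symm), Submodule.mem_bot] at this
  apply le_antisymm
  · -- descending induction on `t`, starting from `𝔪 ^ T = 0`
    obtain h | h := le_total T t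
    · rw [eq_bot_mono (Ideal.pow_le_pow_right h) hzero]
      simp
    · induction h using Nat.decreasingInduction with
      | self =>
        rw [hzero]
        simp
      | of_succ t _ ih => exact (hstep t).trans (sup_le le_rfl (ih.trans (hW t.le_succ)))
  · rw [Submodule.span_le]
    rintro _ ⟨s, ⟨_, hs⟩, rfl⟩
    change _ ∈ 𝔪 ^ t
    rw [← Ideal.map_pow]
    exact Ideal.mem_map_of_mem _ (MvPowerSeries.monomial_mem_maximalIdeal_pow hs)

theorem finite_quotient_of_monomial_span {m : ℕ} {K : Type*} [Field K]
    {I : Ideal (MvPowerSeries (Fin m) K)} {S : Finset (Fin m →₀ ℕ)}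
    (hspan : ∀ n : Fin m →₀ ℕ, Ideal.Quotient.mk I (MvPowerSeries.monomial n 1) ∈
      Submodule.span K ((fun s => Ideal.Quotient.mk I (MvPowerSeries.monomial s 1)) ''
        {s | s ∈ S ∧ n.degree ≤ s.degree})) :
    Module.Finite K (MvPowerSeries (Fin m) K ⧸ I) := by
  have h := map_maximalIdeal_pow_eq_span hspan 0
  rw [Submodule.pow_zero, Ideal.one_eq_top, Submodule.restrictScalars_top] at h
  refine ⟨h ▸ Submodule.fg_span ?_⟩
  exact Set.Finite.image _ (S.finite_toSet.subset fun s hs => hs.1)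

theorem hilbertFunction_eq_card {m : ℕ} {K : Type*} [Field K]
    {I : Ideal (MvPowerSeries (Fin m) K)} {S : Finset (Fin m →₀ ℕ)}
    (hlin : LinearIndepOn K (fun s => Ideal.Quotient.mk I (MvPowerSeries.monomial s 1))
      (S : Set (Fin m →₀ ℕ)))
    (hspan : ∀ n : Fin m →₀ ℕ, Ideal.Quotient.mk I (MvPowerSeries.monomial n 1) ∈
      Submodule.span K ((fun s => Ideal.Quotient.mk I (MvPowerSeries.monomial s 1)) ''
        {s | s ∈ S ∧ n.degree ≤ s.degree})) (t : ℕ) :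
    hilbertFunction I t = (S.filter fun s => s.degree = t).card := by
  have := finite_quotient_of_monomial_span hspan
  set 𝔪 := (IsLocalRing.maximalIdeal (MvPowerSeries (Fin m) K)).map (Ideal.Quotient.mk I)
  have hrank : ∀ t, Module.finrank K ((𝔪 ^ t).restrictScalars K) =
      (S.filter fun s => t ≤ s.degree).card := by
    intro t
    rw [map_maximalIdeal_pow_eq_span hspan t]
    have hS : {s | s ∈ S ∧ t ≤ s.degree} =
        ((S.filter fun s => t ≤ s.degree : Finset (Fin m →₀ ℕ)) : Set (Fin m →₀ ℕ)) := by
      ext s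
      simp
    have hl := hlin.mono (show {s | s ∈ S ∧ t ≤ s.degree} ⊆ (S : Set _) from fun s hs => hs.1)
    rw [hS] at hl ⊢
    rw [Set.image_eq_range, finrank_span_eq_card hl]
    exact Fintype.card_coe _
  have hle : 𝔪 ^ (t + 1) ≤ 𝔪 ^ t := Ideal.pow_le_pow_right t.le_succ
  have h1 : hilbertFunction I t =
      Module.finrank K (↥(𝔪 ^ t) ⧸ ((𝔪 ^ (t + 1)).submoduleOf (𝔪 ^ t)).restrictScalars K) :=
    (LinearEquiv.finrank_eq (Submodule.Quotient.restrictScalarsEquiv K _)).symm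
  have h2 : Module.finrank K (((𝔪 ^ (t + 1)).submoduleOf (𝔪 ^ t)).restrictScalars K) =
      Module.finrank K ((𝔪 ^ (t + 1)).restrictScalars K) :=
    LinearEquiv.finrank_eq ((Submodule.submoduleOfEquivOfLe hle).restrictScalars K)
  have : Module.Finite K ↥(𝔪 ^ t) :=
    inferInstanceAs (Module.Finite K ((𝔪 ^ t).restrictScalars K))
  have h3 := Submodule.finrank_quotient_add_finrank
    (((𝔪 ^ (t + 1)).submoduleOf (𝔪 ^ t)).restrictScalars K)
  have h4 : Module.finrank K ↥(𝔪 ^ t) = Module.finrank K ((𝔪 ^ t).restrictScalars K) := rfl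
  rw [← h1, h2, h4, hrank, hrank] at h3
  have h5 : (S.filter fun s => t ≤ s.degree).card =
      (S.filter fun s => s.degree = t).card + (S.filter fun s => t + 1 ≤ s.degree).card := by
    rw [← Finset.card_union_of_disjoint]
    · congr 1
      ext s
      simp only [Finset.mem_filter, Finset.mem_union]
      grind
    · rw [Finset.disjoint_filter]
      omega
  omega

/-! ### Apolar ideals from dual monomials -/

theorem mem_apolarIdeal_iff {m : ℕ} {K : Type*} [Field K] {F : MvPolynomial (Fin m) K}
    {f : MvPowerSeries (Fin m) K} : f ∈ apolarIdeal F ↔ contraction f F = 0 :=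
  Submodule.mem_annihilator_span_singleton F f

theorem coeff_contraction_monomial {m : ℕ} {K : Type*} [Field K] (n k : Fin m →₀ ℕ)
    (F : MvPolynomial (Fin m) K) :
    MvPolynomial.coeff k (contraction (MvPowerSeries.monomial n 1) F) =
      MvPolynomial.coeff (n + k) F := by
  classical
  have h : MvPolynomial.lcoeff K k ∘ₗ contraction (MvPowerSeries.monomial n 1) =
      MvPolynomial.lcoeff K (n + k) := by
    refine (MvPolynomial.basisMonomials (Fin m) K).ext fun l => ?_
    simp only [MvPolynomial.coe_basisMonomials, LinearMap.comp_apply,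
      contraction_monomial_monomial, MvPolynomial.lcoeff_apply, MvPolynomial.coeff_monomial]
    split_ifs with h1 h2 h2
    · rw [MvPolynomial.coeff_monomial, if_pos (by rw [h2, add_tsub_cancel_left])]
    · rw [MvPolynomial.coeff_monomial, if_neg]
      rintro rfl
      exact h2 (add_tsub_cancel_of_le h1).symm
    · exact absurd (h2 ▸ le_self_add) h1
    · simp
  exact LinearMap.congr_fun h F

theorem contraction_smul {m : ℕ} {K : Type*} [Field K] (c : K) (f : MvPowerSeries (Fin m) K)
    (F : MvPolynomial (Fin m) K) : contraction (c • f) F = c • contraction f F := by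
  have h : contraction (c • f) = c • contraction f := by
    refine (MvPolynomial.basisMonomials (Fin m) K).ext fun n => ?_
    simp [contraction_monomial, Finset.smul_sum, MvPolynomial.smul_monomial]
  rw [h, LinearMap.smul_apply]

/-- The functional `f ↦ coeff_k (f ∘ F)` on power series. -/
noncomputable def coeffContraction {m : ℕ} {K : Type*} [Field K] (F : MvPolynomial (Fin m) K)
    (k : Fin m →₀ ℕ) : MvPowerSeries (Fin m) K →ₗ[K] K where
  toFun f := MvPolynomial.coeff k (contraction f F)
  map_add' f g := by rw [contraction_add, MvPolynomial.coeff_add]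
  map_smul' c f := by rw [contraction_smul, MvPolynomial.coeff_smul, RingHom.id_apply]

/-- A linear combination of the monomials with exponents in `S` which annihilates `F` vanishes,
if each `s ∈ S` has a dual exponent `d s`: contracting `F` by it and reading off the coefficient
at `d s` recovers the coefficient of `x ^ s`. -/
theorem eq_zero_of_sum_mem_apolarIdeal {m : ℕ} {K : Type*} [Field K] {F : MvPolynomial (Fin m) K}
    {S : Finset (Fin m →₀ ℕ)} {d : (Fin m →₀ ℕ) → Fin m →₀ ℕ}
    (hd : ∀ s ∈ S, ∀ s' ∈ S, MvPolynomial.coeff (s' + d s) F = if s' = s then 1 else 0)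
    {c : (Fin m →₀ ℕ) → K}
    (hc : ∑ s ∈ S, c s • MvPowerSeries.monomial s (1 : K) ∈ apolarIdeal F) :
    ∀ s ∈ S, c s = 0 := by
  intro s hs
  have h : coeffContraction F (d s) (∑ s ∈ S, c s • MvPowerSeries.monomial s (1 : K)) = 0 := by
    change MvPolynomial.coeff (d s) (contraction _ F) = 0
    rw [mem_apolarIdeal_iff.1 hc, MvPolynomial.coeff_zero]
  rw [map_sum, Finset.sum_eq_single s] at h
  · rw [map_smul] at h
    change c s • MvPolynomial.coeff (d s) (contraction _ F) = 0 at h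
    rwa [coeff_contraction_monomial, hd s hs s hs, if_pos rfl, smul_eq_mul, mul_one] at h
  · intro s' hs' hne
    rw [map_smul]
    change c s' • MvPolynomial.coeff (d s) (contraction _ F) = 0
    rw [coeff_contraction_monomial, hd s hs s' hs', if_neg hne, smul_zero]
  · exact fun h => absurd hs h

/-- The criterion by which the apolar ideal and its Hilbert function are computed: the monomials
with exponents in `S` are linearly independent even modulo `ann F`, because of the dual exponents
`d`, and they span `R / I` for an ideal `I ≤ ann F`; so `I = ann F`, and `S` is a basis of the
quotient. -/
theorem apolarIdeal_eq_of_monomial_span {m : ℕ} {K : Type*} [Field K]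
    {F : MvPolynomial (Fin m) K} {I : Ideal (MvPowerSeries (Fin m) K)}
    {S : Finset (Fin m →₀ ℕ)} {d : (Fin m →₀ ℕ) → Fin m →₀ ℕ}
    (hd : ∀ s ∈ S, ∀ s' ∈ S, MvPolynomial.coeff (s' + d s) F = if s' = s then 1 else 0)
    (hI : I ≤ apolarIdeal F)
    (hspan : ∀ n : Fin m →₀ ℕ, Ideal.Quotient.mk I (MvPowerSeries.monomial n 1) ∈
      Submodule.span K ((fun s => Ideal.Quotient.mk I (MvPowerSeries.monomial s 1)) ''
        {s | s ∈ S ∧ n.degree ≤ s.degree})) :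
    apolarIdeal F = I ∧ IsArtinianRing (MvPowerSeries (Fin m) K ⧸ apolarIdeal F) ∧
      ∀ t, hilbertFunction (apolarIdeal F) t = (S.filter fun s => s.degree = t).card := by
  have hmk : ∀ c : (Fin m →₀ ℕ) → K,
      ∑ s ∈ S, c s • Ideal.Quotient.mk I (MvPowerSeries.monomial s (1 : K)) =
        Ideal.Quotient.mk I (∑ s ∈ S, c s • MvPowerSeries.monomial s (1 : K)) := by
    intro c
    rw [map_sum]
    rfl
  have heq : apolarIdeal F = I := by
    refine le_antisymm (fun f hf => ?_) hI
    have h0 := map_maximalIdeal_pow_eq_span hspan 0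
    rw [Submodule.pow_zero, Ideal.one_eq_top, Submodule.restrictScalars_top] at h0
    have h1 : Ideal.Quotient.mk I f ∈ Submodule.span K
        ((fun s => Ideal.Quotient.mk I (MvPowerSeries.monomial s (1 : K))) ''
          (S : Set (Fin m →₀ ℕ))) := by
      have : Ideal.Quotient.mk I f ∈ (⊤ : Submodule K (MvPowerSeries (Fin m) K ⧸ I)) := trivial
      rw [h0] at this
      exact Submodule.span_mono (Set.image_mono fun s hs => hs.1) this
    rw [Submodule.mem_span_image_finset_iff_exists_fun] at h1
    obtain ⟨c, hc⟩ := h1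
    let c' : (Fin m →₀ ℕ) → K := fun s => if h : s ∈ S then c ⟨s, h⟩ else 0
    have hc' : Ideal.Quotient.mk I (∑ s ∈ S, c' s • MvPowerSeries.monomial s (1 : K)) =
        Ideal.Quotient.mk I f := by
      rw [← hmk, ← hc, ← Finset.sum_coe_sort]
      refine Finset.sum_congr rfl fun s _ => ?_
      simp [c']
    have h2 : ∑ s ∈ S, c' s • MvPowerSeries.monomial s (1 : K) ∈ apolarIdeal F := by
      rw [Ideal.Quotient.eq] at hc'
      have := add_mem (hI hc') hf
      rwa [sub_add_cancel] at this
    have h3 := eq_zero_of_sum_mem_apolarIdeal hd h2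
    rw [Finset.sum_eq_zero fun s hs => by rw [h3 s hs, zero_smul], map_zero] at hc'
    exact Ideal.Quotient.eq_zero_iff_mem.1 hc'.symm
  have hlin : LinearIndepOn K (fun s => Ideal.Quotient.mk I (MvPowerSeries.monomial s (1 : K)))
      (S : Set (Fin m →₀ ℕ)) := by
    rw [linearIndepOn_finset_iff]
    intro c hc
    rw [hmk, Ideal.Quotient.eq_zero_iff_mem] at hc
    exact eq_zero_of_sum_mem_apolarIdeal hd (hI hc)
  rw [heq]
  have := finite_quotient_of_monomial_span hspan
  exact ⟨rfl, IsArtinianRing.of_finite K _, hilbertFunction_eq_card hlin hspan⟩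

/-! ### Regular sequences -/

open RingTheory.Sequence in
theorem isWeaklyRegular_append_singleton_iff {R : Type*} [CommRing R] (rs : List R) (a : R) :
    IsWeaklyRegular R (rs ++ [a]) ↔
      IsWeaklyRegular R rs ∧ ∀ s, a * s ∈ Ideal.ofList rs → s ∈ Ideal.ofList rs := by
  rw [isWeaklyRegular_append_iff, isWeaklyRegular_singleton_iff,
    isSMulRegular_iff_right_eq_zero_of_smul]
  refine and_congr_right fun _ => ?_
  have hmem : ∀ s : R, (Submodule.Quotient.mk s : R ⧸ (Ideal.ofList rs • ⊤ : Ideal R)) = 0 ↔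
      s ∈ Ideal.ofList rs := fun s => by
    rw [Submodule.Quotient.mk_eq_zero, smul_eq_mul, Ideal.mul_top]
  constructor
  · intro h s hs
    exact (hmem s).1 (h _ ((hmem (a * s)).2 hs))
  · intro h x
    obtain ⟨s, rfl⟩ := Submodule.Quotient.mk_surjective _ x
    intro hs
    exact (hmem s).2 (h s ((hmem (a * s)).1 hs))

open RingTheory.Sequence in
/-- The last member of a regular sequence may be replaced by any divisor of it modulo the others. -/
theorem IsWeaklyRegular.replace_last {R : Type*} [CommRing R] {rs : List R} {a b : R}
    (h : IsWeaklyRegular R (rs ++ [a])) (hab : a ∈ Ideal.ofList rs ⊔ Ideal.span {b}) :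
    IsWeaklyRegular R (rs ++ [b]) := by
  rw [isWeaklyRegular_append_singleton_iff] at h ⊢
  refine ⟨h.1, fun s hs => h.2 s ?_⟩
  obtain ⟨r, hr, q, hq, rfl⟩ := Submodule.mem_sup.1 hab
  obtain ⟨q, rfl⟩ := Ideal.mem_span_singleton'.1 hq
  have : (r + q * b) * s = s * r + q * (b * s) := by ring
  rw [this]
  exact add_mem (Ideal.mul_mem_left _ _ hr) (Ideal.mul_mem_left _ _ hs)

open RingTheory.Sequence in
theorem IsWeaklyRegular.pow_last {R : Type*} [CommRing R] {rs : List R} {a : R}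
    (h : IsWeaklyRegular R (rs ++ [a])) (n : ℕ) : IsWeaklyRegular R (rs ++ [a ^ n]) := by
  rw [isWeaklyRegular_append_singleton_iff] at h ⊢
  refine ⟨h.1, ?_⟩
  induction n with
  | zero => simp
  | succ n ih =>
    intro s hs
    rw [pow_succ, mul_assoc] at hs
    exact h.2 s (ih _ hs)

open RingTheory.Sequence in
theorem MvPowerSeries.isWeaklyRegular_X {K : Type*} [Field K] :
    IsWeaklyRegular (MvPowerSeries (Fin 3) K)
      [(X 0 : MvPowerSeries (Fin 3) K), X 1, X 2] := by
  classical
  have key : ∀ (s : Finset (Fin 3)) (i : Fin 3), i ∉ s → ∀ f : MvPowerSeries (Fin 3) K,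
      X i * f ∈ Ideal.span (X (R := K) '' (s : Set (Fin 3))) →
      f ∈ Ideal.span (X (R := K) '' (s : Set (Fin 3))) := by
    intro s i hi f hf
    rw [mem_span_X_iff] at hf ⊢
    intro n hn
    have := hf (Finsupp.single i 1 + n) fun j hj => by
      have hij : i ≠ j := fun h => hi (h ▸ hj)
      rw [Finsupp.add_apply, Finsupp.single_eq_of_ne' hij, hn j hj]
    rwa [X_def, coeff_add_monomial_mul, one_mul] at this
  have h0 : Ideal.ofList ([] : List (MvPowerSeries (Fin 3) K)) =
      Ideal.span (X (R := K) '' ((∅ : Finset (Fin 3)) : Set (Fin 3))) := by simp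
  have h1 : Ideal.ofList [(X 0 : MvPowerSeries (Fin 3) K)] =
      Ideal.span (X (R := K) '' (({0} : Finset (Fin 3)) : Set (Fin 3))) := by simp
  have h2 : Ideal.ofList [(X 0 : MvPowerSeries (Fin 3) K), X 1] =
      Ideal.span (X (R := K) '' (({0, 1} : Finset (Fin 3)) : Set (Fin 3))) := by
    simp [Set.image_pair, Ideal.span_insert]
  refine (isWeaklyRegular_append_singleton_iff [X 0, X 1] (X 2)).2 ⟨?_, ?_⟩
  · refine (isWeaklyRegular_append_singleton_iff [X 0] (X 1)).2 ⟨?_, ?_⟩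
    · refine (isWeaklyRegular_append_singleton_iff [] (X 0)).2 ⟨.nil _ _, ?_⟩
      rw [h0]
      exact key _ _ (by decide)
    · rw [h1]
      exact key _ _ (by decide)
  · rw [h2]
    exact key _ _ (by decide)

open RingTheory.Sequence in
theorem MvPowerSeries.isWeaklyRegular_X_pow {K : Type*} [Field K] {i j k : ℕ}
    (hi : i ≠ 0) (hj : j ≠ 0) (hk : k ≠ 0) :
    IsWeaklyRegular (MvPowerSeries (Fin 3) K)
      [(X 0 : MvPowerSeries (Fin 3) K) ^ i, X 1 ^ j, X 2 ^ k] := by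
  have hm : ∀ {n : ℕ} (l : Fin 3), n ≠ 0 → (X l : MvPowerSeries (Fin 3) K) ^ n ∈
      IsLocalRing.maximalIdeal (MvPowerSeries (Fin 3) K) := fun l hn =>
    Ideal.pow_mem_of_mem _ ((mem_maximalIdeal_iff _).2 (constantCoeff_X l)) _
      (Nat.pos_of_ne_zero hn)
  have hm1 : ∀ l : Fin 3, (X l : MvPowerSeries (Fin 3) K) ∈
      IsLocalRing.maximalIdeal (MvPowerSeries (Fin 3) K) := fun l => by
    simpa using hm l one_ne_zero
  -- each variable is moved to the last place, where it may be raised to a power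
  have h1 := IsWeaklyRegular.pow_last (rs := [X 0, X 1]) (isWeaklyRegular_X (K := K)) k
  have h2 := IsWeaklyRegular.pow_last (rs := [X 0, X 2 ^ k])
    (IsLocalRing.isWeaklyRegular_of_perm_of_subset_maximalIdeal h1
      (rs' := [X 0, X 2 ^ k, X 1]) (by simpa using List.Perm.swap _ _ _)
      (by simp [-IsLocalRing.mem_maximalIdeal, hm1, hm _ hk])) j
  have h3 := IsWeaklyRegular.pow_last (rs := [X 1 ^ j, X 2 ^ k])
    (IsLocalRing.isWeaklyRegular_of_perm_of_subset_maximalIdeal h2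
      (rs' := [X 1 ^ j, X 2 ^ k, X 0]) (List.reverse_perm _).symm
      (by simp [-IsLocalRing.mem_maximalIdeal, hm1, hm _ hk, hm _ hj])) i
  exact IsLocalRing.isWeaklyRegular_of_perm_of_subset_maximalIdeal h3
    (List.perm_append_comm (l₁ := [X 1 ^ j, X 2 ^ k]) (l₂ := [X 0 ^ i]))
    (by simp [-IsLocalRing.mem_maximalIdeal, hm _ hi, hm _ hk, hm _ hj])

open RingTheory.Sequence in
theorem isCompleteIntersection_X_sq {K : Type*} [Field K] :
    IsCompleteIntersection (Ideal.span {(MvPowerSeries.X 0 : MvPowerSeries (Fin 3) K) ^ 2,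
      MvPowerSeries.X 1 ^ 2, MvPowerSeries.X 2 ^ 2}) := by
  refine ⟨_, IsRegular.of_isWeaklyRegular_of_mem_maximalIdeal _ ?_
    (MvPowerSeries.isWeaklyRegular_X_pow two_ne_zero two_ne_zero two_ne_zero), ?_⟩
  · simp [-IsLocalRing.mem_maximalIdeal, MvPowerSeries.mem_maximalIdeal_iff]
  · simp [Ideal.span_insert]

open RingTheory.Sequence MvPowerSeries in
/-- Starting from powers of the variables, the three generators are brought in one at a time, each
replacing a power of a variable which it divides modulo the remaining members of the sequence. -/
theorem isCompleteIntersection_of_X_pow_mem {K : Type*} [Field K] {p q r N : ℕ}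
    (hp : p ≠ 0) (hq : q ≠ 0) (hr : r ≠ 0) (hN : N ≠ 0)
    (h : (X 0 : MvPowerSeries (Fin 3) K) ^ N ∈ Ideal.span
      {(X 1 * X 2 - X 0 ^ p : MvPowerSeries (Fin 3) K), X 0 * X 2 - X 1 ^ q,
        X 0 * X 1 - X 2 ^ r}) :
    IsCompleteIntersection (Ideal.span
      {(X 1 * X 2 - X 0 ^ p : MvPowerSeries (Fin 3) K), X 0 * X 2 - X 1 ^ q,
        X 0 * X 1 - X 2 ^ r}) := by
  set x : MvPowerSeries (Fin 3) K := X 0 with hx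
  set y : MvPowerSeries (Fin 3) K := X 1 with hy
  set z : MvPowerSeries (Fin 3) K := X 2 with hz
  have hmx : constantCoeff x = 0 := constantCoeff_X 0
  have hmy : constantCoeff y = 0 := constantCoeff_X 1
  have hmz : constantCoeff z = 0 := constantCoeff_X 2
  have h0 : IsWeaklyRegular (MvPowerSeries (Fin 3) K) ([x ^ N, y ^ (q * N)] ++ [z ^ (r * N)]) :=
    isWeaklyRegular_X_pow hN (mul_ne_zero hq hN) (mul_ne_zero hr hN)
  have h1 : IsWeaklyRegular (MvPowerSeries (Fin 3) K)
      ([x ^ N, y ^ (q * N)] ++ [x * y - z ^ r]) := by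
    refine IsWeaklyRegular.replace_last h0 ?_
    obtain ⟨c, hc⟩ := sub_dvd_pow_sub_pow (x * y) (z ^ r) N
    have : z ^ (r * N) = y ^ N * x ^ N + -c * (x * y - z ^ r) := by
      rw [pow_mul]
      linear_combination -hc
    rw [this]
    exact Submodule.add_mem_sup (Ideal.mul_mem_left _ _ (Ideal.subset_span (by simp)))
      (Ideal.mul_mem_left _ _ (Ideal.mem_span_singleton_self _))
  have h2 : IsWeaklyRegular (MvPowerSeries (Fin 3) K)
      ([x * y - z ^ r, x ^ N] ++ [y ^ (q * N)]) :=
    IsLocalRing.isWeaklyRegular_of_perm_of_subset_maximalIdeal h1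
      (List.perm_append_comm (l₁ := [x ^ N, y ^ (q * N)]) (l₂ := [x * y - z ^ r]))
      (by simp [-IsLocalRing.mem_maximalIdeal, mem_maximalIdeal_iff, hmx, hmy, hmz, hq, hr, hN])
  have h3 : IsWeaklyRegular (MvPowerSeries (Fin 3) K)
      ([x * y - z ^ r, x ^ N] ++ [x * z - y ^ q]) := by
    refine IsWeaklyRegular.replace_last h2 ?_
    obtain ⟨c, hc⟩ := sub_dvd_pow_sub_pow (x * z) (y ^ q) N
    have : y ^ (q * N) = z ^ N * x ^ N + -c * (x * z - y ^ q) := by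
      rw [pow_mul]
      linear_combination -hc
    rw [this]
    exact Submodule.add_mem_sup (Ideal.mul_mem_left _ _ (Ideal.subset_span (by simp)))
      (Ideal.mul_mem_left _ _ (Ideal.mem_span_singleton_self _))
  have h4 : IsWeaklyRegular (MvPowerSeries (Fin 3) K)
      ([x * y - z ^ r, x * z - y ^ q] ++ [x ^ N]) :=
    IsLocalRing.isWeaklyRegular_of_perm_of_subset_maximalIdeal h3
      (List.Perm.cons _ (List.Perm.swap _ _ _))
      (by simp [-IsLocalRing.mem_maximalIdeal, mem_maximalIdeal_iff, hmx, hmy, hmz, hq, hr, hN])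
  have hI : Ideal.span {y * z - x ^ p, x * z - y ^ q, x * y - z ^ r} =
      Ideal.ofList [x * y - z ^ r, x * z - y ^ q] ⊔ Ideal.span {y * z - x ^ p} := by
    simp only [Ideal.span_insert, Ideal.ofList_cons, Ideal.ofList_nil, sup_bot_eq]
    ac_rfl
  have h5 : IsWeaklyRegular (MvPowerSeries (Fin 3) K)
      ([x * y - z ^ r, x * z - y ^ q] ++ [y * z - x ^ p]) :=
    IsWeaklyRegular.replace_last h4 (hI ▸ h)
  refine ⟨_, IsRegular.of_isWeaklyRegular_of_mem_maximalIdeal _ ?_ h5, ?_⟩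
  · simp [-IsLocalRing.mem_maximalIdeal, mem_maximalIdeal_iff, hmx, hmy, hmz, hp, hq, hr]
  · rw [hI, Ideal.ofList_append, Ideal.ofList_singleton]

/-! ### Exponents of monomials in three variables -/

/-- The exponent `(i, j, k)` of the monomial `x ^ i * y ^ j * z ^ k`. -/
noncomputable def exponent (i j k : ℕ) : Fin 3 →₀ ℕ :=
  Finsupp.single 0 i + Finsupp.single 1 j + Finsupp.single 2 k

@[simp] theorem exponent_zero (i j k : ℕ) : exponent i j k 0 = i := by simp [exponent]

@[simp] theorem exponent_one (i j k : ℕ) : exponent i j k 1 = j := by simp [exponent]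

@[simp] theorem exponent_two (i j k : ℕ) : exponent i j k 2 = k := by simp [exponent]

theorem exists_eq_exponent (n : Fin 3 →₀ ℕ) : ∃ i j k, n = exponent i j k := by
  refine ⟨n 0, n 1, n 2, Finsupp.ext fun l => ?_⟩
  fin_cases l <;> simp

theorem exponent_inj {i j k i' j' k' : ℕ} :
    exponent i j k = exponent i' j' k' ↔ i = i' ∧ j = j' ∧ k = k' := by
  refine ⟨fun h => ⟨?_, ?_, ?_⟩, by rintro ⟨rfl, rfl, rfl⟩; rfl⟩
  · simpa using DFunLike.congr_fun h 0
  · simpa using DFunLike.congr_fun h 1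
  · simpa using DFunLike.congr_fun h 2

theorem exponent_add (i j k i' j' k' : ℕ) :
    exponent i j k + exponent i' j' k' = exponent (i + i') (j + j') (k + k') := by
  ext l
  fin_cases l <;> simp

theorem degree_exponent (i j k : ℕ) : (exponent i j k).degree = i + j + k := by
  simp [exponent]

theorem MvPowerSeries.monomial_exponent {K : Type*} [CommRing K] (i j k : ℕ) :
    MvPowerSeries.monomial (exponent i j k) (1 : K) = X 0 ^ i * X 1 ^ j * X 2 ^ k := by
  simp [exponent, X_pow_eq, monomial_mul_monomial]

theorem MvPolynomial.monomial_exponent {K : Type*} [CommRing K] (i j k : ℕ) :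
    MvPolynomial.monomial (exponent i j k) (1 : K) = X 0 ^ i * X 1 ^ j * X 2 ^ k := by
  simp [exponent, X_pow_eq_monomial, monomial_mul]

/-- Two monomials take the same value on `F` if the coefficients of `F` are the same at all
translates of their exponents. -/
theorem monomial_sub_monomial_mem_apolarIdeal {K : Type*} [Field K] {F : MvPolynomial (Fin 3) K}
    {n n' : Fin 3 →₀ ℕ}
    (h : ∀ i j k, MvPolynomial.coeff (n + exponent i j k) F =
      MvPolynomial.coeff (n' + exponent i j k) F) :
    MvPowerSeries.monomial n (1 : K) - MvPowerSeries.monomial n' 1 ∈ apolarIdeal F := by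
  rw [mem_apolarIdeal_iff]
  ext l
  obtain ⟨i, j, k, rfl⟩ := exists_eq_exponent l
  change coeffContraction F _ _ = _
  rw [map_sub, MvPolynomial.coeff_zero, sub_eq_zero]
  change MvPolynomial.coeff _ (contraction _ F) = MvPolynomial.coeff _ (contraction _ F)
  rw [coeff_contraction_monomial, coeff_contraction_monomial, h]

/-! ### The squarefree case -/

/-- The exponents of the squarefree monomials in three variables. -/
noncomputable def squarefreeExponents : Finset (Fin 3 →₀ ℕ) :=
  (Finset.range 2 ×ˢ Finset.range 2 ×ˢ Finset.range 2).image fun n => exponent n.1 n.2.1 n.2.2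

theorem exponent_mem_squarefreeExponents {i j k : ℕ} :
    exponent i j k ∈ squarefreeExponents ↔ i < 2 ∧ j < 2 ∧ k < 2 := by
  simp only [squarefreeExponents, Finset.mem_image, Finset.mem_product, Finset.mem_range,
    exponent_inj, Prod.exists]
  grind

theorem card_squarefreeExponents_degree (t : ℕ) :
    (squarefreeExponents.filter fun s => s.degree = t).card = hSequence 0 0 0 t := by
  rw [squarefreeExponents, Finset.filter_image, Finset.card_image_of_injective]
  · simp only [degree_exponent]
    match t with
    | 0 | 1 | 2 | 3 => decide
    | t + 4 =>
      rw [Finset.filter_false_of_mem]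
      · simp [hSequence]
      · simp only [Finset.mem_product, Finset.mem_range]
        omega
  · rintro ⟨i, j, k⟩ ⟨i', j', k'⟩ h
    simpa [exponent_inj] using h

open MvPowerSeries in
theorem apolarIdeal_X_mul_Y_mul_Z {K : Type*} [Field K] {F : MvPolynomial (Fin 3) K}
    (hF : F = MvPolynomial.X 0 * MvPolynomial.X 1 * MvPolynomial.X 2) :
    apolarIdeal F = Ideal.span {(X 0 : MvPowerSeries (Fin 3) K) ^ 2, X 1 ^ 2, X 2 ^ 2} ∧
      IsArtinianRing (MvPowerSeries (Fin 3) K ⧸ apolarIdeal F) ∧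
      hilbertFunction (apolarIdeal F) = hSequence 0 0 0 := by
  have hcoeff : ∀ i j k, MvPolynomial.coeff (exponent i j k) F =
      if i = 1 ∧ j = 1 ∧ k = 1 then 1 else 0 := by
    intro i j k
    have : F = MvPolynomial.monomial (exponent 1 1 1) 1 := by
      rw [MvPolynomial.monomial_exponent, hF]
      simp
    rw [this, MvPolynomial.coeff_monomial]
    simp only [exponent_inj, eq_comm]
  set I := Ideal.span {(X 0 : MvPowerSeries (Fin 3) K) ^ 2, X 1 ^ 2, X 2 ^ 2} with hI
  have hX : ∀ l, (X l : MvPowerSeries (Fin 3) K) ^ 2 ∈ I := by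
    intro l
    apply Ideal.subset_span
    fin_cases l <;> simp
  simp only [funext_iff, ← card_squarefreeExponents_degree]
  refine apolarIdeal_eq_of_monomial_span (S := squarefreeExponents)
    (d := fun n => exponent (1 - n 0) (1 - n 1) (1 - n 2)) ?_ ?_ ?_
  · intro s hs s' hs'
    obtain ⟨i, j, k, rfl⟩ := exists_eq_exponent s
    obtain ⟨i', j', k', rfl⟩ := exists_eq_exponent s'
    rw [exponent_mem_squarefreeExponents] at hs hs'
    simp only [exponent_zero, exponent_one, exponent_two, exponent_add, hcoeff, exponent_inj]
    exact if_congr (by omega) rfl rfl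
  · have hm : ∀ n : Fin 3 →₀ ℕ,
        (∀ i j k, MvPolynomial.coeff (n + exponent i j k) F = 0) →
        MvPowerSeries.monomial n (1 : K) ∈ apolarIdeal F := by
      intro n hn
      rw [mem_apolarIdeal_iff]
      ext l
      obtain ⟨i, j, k, rfl⟩ := exists_eq_exponent l
      rw [coeff_contraction_monomial, hn, MvPolynomial.coeff_zero]
    rw [hI, Ideal.span_le]
    rintro _ (rfl | rfl | rfl)
    · have := hm (exponent 2 0 0) fun i j k => by
        rw [exponent_add, hcoeff, if_neg (by omega)]
      simpa [MvPowerSeries.monomial_exponent] using this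
    · have := hm (exponent 0 2 0) fun i j k => by
        rw [exponent_add, hcoeff, if_neg (by omega)]
      simpa [MvPowerSeries.monomial_exponent] using this
    · have := hm (exponent 0 0 2) fun i j k => by
        rw [exponent_add, hcoeff, if_neg (by omega)]
      simpa [MvPowerSeries.monomial_exponent] using this
  · intro n
    obtain ⟨i, j, k, rfl⟩ := exists_eq_exponent n
    by_cases h : i < 2 ∧ j < 2 ∧ k < 2
    · exact Submodule.subset_span ⟨_, ⟨exponent_mem_squarefreeExponents.2 h, le_rfl⟩, rfl⟩
    · suffices h0 : MvPowerSeries.monomial (exponent i j k) (1 : K) ∈ I by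
        rw [Ideal.Quotient.eq_zero_iff_mem.2 h0]
        exact zero_mem _
      rw [MvPowerSeries.monomial_exponent]
      obtain h | h | h : 2 ≤ i ∨ 2 ≤ j ∨ 2 ≤ k := by omega
      · exact Ideal.mem_of_dvd _
          (((pow_dvd_pow _ h).trans (dvd_mul_right _ _)).trans (dvd_mul_right _ _)) (hX 0)
      · exact Ideal.mem_of_dvd _
          (((pow_dvd_pow _ h).trans (dvd_mul_left _ _)).trans (dvd_mul_right _ _)) (hX 1)
      · exact Ideal.mem_of_dvd _ ((pow_dvd_pow _ h).trans (dvd_mul_left _ _)) (hX 2)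

/-! ### The general case -/

/-- Running once through the three relations turns `x ^ 2 * y` into a multiple of itself by
`x ^ P * y ^ Q * z ^ R`. -/
theorem sq_mul_eq_zero_of_relations {A : Type*} [CommRing A] {x y z : A} {P Q R : ℕ}
    (hyz : y * z = x ^ (P + 2)) (hxz : x * z = y ^ (Q + 2)) (hxy : x * y = z ^ (R + 2))
    (hu : IsUnit (1 - x ^ P * y ^ Q * z ^ R)) : x ^ 2 * y = 0 := by
  refine (hu.mul_left_eq_zero).1 ?_
  linear_combination x * hxy + z ^ (R + 1) * hxz + y ^ (Q + 1) * z ^ R * hyz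

/-- The exponents of `x ^ i` for `i ≤ P + 3`, of `y ^ j` for `1 ≤ j ≤ Q + 2` and of `z ^ k` for
`1 ≤ k ≤ R + 2`. The powers `y ^ (Q + 3)` and `z ^ (R + 3)` are left out, since they agree with
`x ^ (P + 3)` in the quotient. -/
noncomputable def axisExponents (P Q R : ℕ) : Finset (Fin 3 →₀ ℕ) :=
  (Finset.range (P + 4)).image (fun i => exponent i 0 0) ∪
    ((Finset.Icc 1 (Q + 2)).image (fun j => exponent 0 j 0) ∪
      (Finset.Icc 1 (R + 2)).image (fun k => exponent 0 0 k))

theorem exponent_mem_axisExponents {P Q R i j k : ℕ} :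
    exponent i j k ∈ axisExponents P Q R ↔
      (i ≤ P + 3 ∧ j = 0 ∧ k = 0) ∨ (i = 0 ∧ 1 ≤ j ∧ j ≤ Q + 2 ∧ k = 0) ∨
        (i = 0 ∧ j = 0 ∧ 1 ≤ k ∧ k ≤ R + 2) := by
  simp only [axisExponents, Finset.mem_union, Finset.mem_image, Finset.mem_range, Finset.mem_Icc,
    exponent_inj]
  constructor
  · rintro (⟨a, _, _, _, _⟩ | ⟨a, _, _, _, _⟩ | ⟨a, _, _, _, _⟩) <;> omega
  · rintro (⟨_, _, _⟩ | ⟨_, _, _, _⟩ | ⟨_, _, _, _⟩)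
    · exact Or.inl ⟨i, by omega⟩
    · exact Or.inr (Or.inl ⟨j, by omega⟩)
    · exact Or.inr (Or.inr ⟨k, by omega⟩)

theorem hSequence_eq (u v w t : ℕ) : hSequence u v w t =
    (if t < u + v + w + 4 then 1 else 0) +
      ((if 1 ≤ t ∧ t ≤ u + v + 2 then 1 else 0) + (if 1 ≤ t ∧ t ≤ u + 2 then 1 else 0)) := by
  rw [hSequence, List.getD_eq_getElem?_getD]
  grind

theorem card_axisExponents_degree (u v w t : ℕ) :
    ((axisExponents (u + v + w) (u + v) u).filter fun s => s.degree = t).card =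
      hSequence u v w t := by
  have hinj0 : Function.Injective fun i => exponent i 0 0 := fun i i' h => (exponent_inj.1 h).1
  have hinj1 : Function.Injective fun j => exponent 0 j 0 := fun i i' h => (exponent_inj.1 h).2.1
  have hinj2 : Function.Injective fun k => exponent 0 0 k := fun i i' h => (exponent_inj.1 h).2.2
  have hcard : ∀ s : Finset ℕ, (s.filter fun i => i = t).card = if t ∈ s then 1 else 0 := by
    intro s
    rw [Finset.filter_eq']
    split_ifs <;> simp
  rw [axisExponents, Finset.filter_union, Finset.filter_union, Finset.card_union_of_disjoint,
    Finset.card_union_of_disjoint, Finset.filter_image, Finset.filter_image, Finset.filter_image,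
    Finset.card_image_of_injective _ hinj0, Finset.card_image_of_injective _ hinj1,
    Finset.card_image_of_injective _ hinj2, hSequence_eq]
  · simp only [degree_exponent, add_zero, zero_add, hcard, Finset.mem_range, Finset.mem_Icc]
  · refine Finset.disjoint_filter_filter (Finset.disjoint_left.2 fun s hs hs' => ?_)
    simp only [Finset.mem_image, Finset.mem_Icc] at hs hs'
    obtain ⟨j, hj, rfl⟩ := hs
    obtain ⟨k, hk, h⟩ := hs'
    rw [exponent_inj] at h
    omega
  · rw [← Finset.filter_union]
    refine Finset.disjoint_filter_filter (Finset.disjoint_left.2 fun s hs hs' => ?_)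
    simp only [Finset.mem_union, Finset.mem_image, Finset.mem_Icc] at hs hs'
    obtain ⟨i, hi, rfl⟩ := hs
    obtain ⟨k, hk, h⟩ | ⟨k, hk, h⟩ := hs' <;>
    · rw [exponent_inj] at h
      omega

open MvPowerSeries in
/-- For `P > 0` the element `1 - x ^ P * y ^ Q * z ^ R` is a unit, so `x ^ 2 * y` and its five
companions vanish modulo `I`, and the relations reduce every other monomial to a power of one
variable; this does not lower the degree, because `Q, R ≤ P`. -/
theorem monomial_mem_span_axisExponents {K : Type*} [Field K] {P Q R : ℕ} (hP : P ≠ 0)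
    (hQP : Q ≤ P) (hRP : R ≤ P) {I : Ideal (MvPowerSeries (Fin 3) K)}
    (hI : I = Ideal.span {X 1 * X 2 - X 0 ^ (P + 2), X 0 * X 2 - X 1 ^ (Q + 2),
      X 0 * X 1 - X 2 ^ (R + 2)}) (n : Fin 3 →₀ ℕ) :
    Ideal.Quotient.mk I (MvPowerSeries.monomial n 1) ∈
      Submodule.span K ((fun s => Ideal.Quotient.mk I (MvPowerSeries.monomial s 1)) ''
        {s | s ∈ axisExponents P Q R ∧ n.degree ≤ s.degree}) := by
  set x := Ideal.Quotient.mk I (X 0) with hx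
  set y := Ideal.Quotient.mk I (X 1) with hy
  set z := Ideal.Quotient.mk I (X 2) with hz
  have hyz : y * z = x ^ (P + 2) := by
    rw [hx, hy, hz, ← map_mul, ← map_pow, Ideal.Quotient.eq, hI]
    exact Ideal.subset_span (by simp)
  have hxz : x * z = y ^ (Q + 2) := by
    rw [hx, hy, hz, ← map_mul, ← map_pow, Ideal.Quotient.eq, hI]
    exact Ideal.subset_span (by simp)
  have hxy : x * y = z ^ (R + 2) := by
    rw [hx, hy, hz, ← map_mul, ← map_pow, Ideal.Quotient.eq, hI]
    exact Ideal.subset_span (by simp)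
  have hu : IsUnit (1 - x ^ P * y ^ Q * z ^ R) := by
    have : IsUnit (1 - X 0 ^ P * X 1 ^ Q * X 2 ^ R : MvPowerSeries (Fin 3) K) := by
      rw [isUnit_iff_constantCoeff]
      simp [hP]
    simpa using this.map (Ideal.Quotient.mk I)
  have hxxy := sq_mul_eq_zero_of_relations hyz hxz hxy hu
  have hxxz := sq_mul_eq_zero_of_relations (x := x) (y := z) (z := y) (P := P) (Q := R) (R := Q)
    (by rw [mul_comm, hyz]) hxy hxz (by convert hu using 2; ring)
  have hyyx := sq_mul_eq_zero_of_relations (x := y) (y := x) (z := z) (P := Q) (Q := P) (R := R)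
    hxz hyz (by rw [mul_comm, hxy]) (by convert hu using 2; ring)
  have hyyz := sq_mul_eq_zero_of_relations (x := y) (y := z) (z := x) (P := Q) (Q := R) (R := P)
    (by rw [mul_comm, hxz]) (by rw [mul_comm, hxy]) hyz (by convert hu using 2; ring)
  have hzzx := sq_mul_eq_zero_of_relations (x := z) (y := x) (z := y) (P := R) (Q := P) (R := Q)
    hxy (by rw [mul_comm, hyz]) (by rw [mul_comm, hxz]) (by convert hu using 2; ring)
  have hzzy := sq_mul_eq_zero_of_relations (x := z) (y := y) (z := x) (P := R) (Q := Q) (R := P)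
    (by rw [mul_comm, hxy]) (by rw [mul_comm, hxz]) (by rw [mul_comm, hyz])
    (by convert hu using 2; ring)
  set W : ℕ → Submodule K (MvPowerSeries (Fin 3) K ⧸ I) := fun t =>
    Submodule.span K ((fun s => Ideal.Quotient.mk I (MvPowerSeries.monomial s 1)) ''
      {s | s ∈ axisExponents P Q R ∧ t ≤ s.degree}) with hW
  have hmem : ∀ {t i j k}, exponent i j k ∈ axisExponents P Q R → t ≤ i + j + k →
      x ^ i * y ^ j * z ^ k ∈ W t := by
    intro t i j k h ht
    refine Submodule.subset_span ⟨exponent i j k, ⟨h, by rwa [degree_exponent]⟩, ?_⟩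
    simp [MvPowerSeries.monomial_exponent, hx, hy, hz]
  have hxW : ∀ {t i}, t ≤ i → x ^ i ∈ W t := by
    intro t i h
    obtain hi | hi := le_or_gt i (P + 3)
    · have := hmem (i := i) (j := 0) (k := 0) (exponent_mem_axisExponents.2 (by omega)) h
      simpa using this
    · obtain ⟨l, rfl⟩ := Nat.exists_eq_add_of_le hi
      have : x ^ (P + 3 + 1 + l) = 0 := by
        linear_combination -x ^ (l + 2) * hyz + x ^ l * z * hxxy
      rw [this]
      exact zero_mem _
  have hyW : ∀ {t j}, t ≤ j → y ^ j ∈ W t := by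
    intro t j h
    obtain rfl | rfl | ⟨hj0, hj⟩ | hj :
      j = 0 ∨ j = Q + 3 ∨ (1 ≤ j ∧ j ≤ Q + 2) ∨ Q + 4 ≤ j := by omega
    · simpa using hxW h
    · have : y ^ (Q + 3) = x ^ (P + 3) := by linear_combination x * hyz - y * hxz
      rw [this]
      exact hxW (by omega)
    · have := hmem (i := 0) (j := j) (k := 0) (exponent_mem_axisExponents.2 (by omega))
        (by omega : t ≤ _)
      simpa using this
    · obtain ⟨l, rfl⟩ := Nat.exists_eq_add_of_le hj
      have : y ^ (Q + 4 + l) = 0 := by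
        linear_combination -y ^ (l + 2) * hxz + y ^ l * z * hyyx
      rw [this]
      exact zero_mem _
  have hzW : ∀ {t k}, t ≤ k → z ^ k ∈ W t := by
    intro t k h
    obtain rfl | rfl | ⟨hk0, hk⟩ | hk :
      k = 0 ∨ k = R + 3 ∨ (1 ≤ k ∧ k ≤ R + 2) ∨ R + 4 ≤ k := by omega
    · simpa using hxW h
    · have : z ^ (R + 3) = x ^ (P + 3) := by linear_combination x * hyz - z * hxy
      rw [this]
      exact hxW (by omega)
    · have := hmem (i := 0) (j := 0) (k := k) (exponent_mem_axisExponents.2 (by omega))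
        (by omega : t ≤ _)
      simpa using this
    · obtain ⟨l, rfl⟩ := Nat.exists_eq_add_of_le hk
      have : z ^ (R + 4 + l) = 0 := by
        linear_combination -z ^ (l + 2) * hxy + z ^ l * y * hzzx
      rw [this]
      exact zero_mem _
  obtain ⟨i, j, k, rfl⟩ := exists_eq_exponent n
  have hn : Ideal.Quotient.mk I (MvPowerSeries.monomial (exponent i j k) 1) =
      x ^ i * y ^ j * z ^ k := by
    simp [MvPowerSeries.monomial_exponent, hx, hy, hz]
  change _ ∈ W (exponent i j k).degree
  rw [hn, degree_exponent]
  have hzero : ∀ {c}, c = 0 → c ∣ x ^ i * y ^ j * z ^ k →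
      x ^ i * y ^ j * z ^ k ∈ W (i + j + k) := by
    rintro _ rfl h
    rw [zero_dvd_iff.1 h]
    exact zero_mem _
  have hp : ∀ {a : MvPowerSeries (Fin 3) K ⧸ I} {l}, 1 ≤ l → a ∣ a ^ l := fun h =>
    dvd_pow_self _ (by omega)
  obtain h | h | h | h | h | h | h : (2 ≤ i ∧ 1 ≤ j) ∨ (2 ≤ i ∧ 1 ≤ k) ∨ (2 ≤ j ∧ 1 ≤ i) ∨
    (2 ≤ j ∧ 1 ≤ k) ∨ (2 ≤ k ∧ 1 ≤ i) ∨ (2 ≤ k ∧ 1 ≤ j) ∨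
    ((j = 0 ∧ k = 0) ∨ (i = 0 ∧ k = 0) ∨ (i = 0 ∧ j = 0) ∨ (i = 0 ∧ j = 1 ∧ k = 1) ∨
      (i = 1 ∧ j = 0 ∧ k = 1) ∨ (i = 1 ∧ j = 1 ∧ k = 0) ∨ (i = 1 ∧ j = 1 ∧ k = 1)) := by omega
  · exact hzero hxxy ((mul_dvd_mul (pow_dvd_pow _ h.1) (hp h.2)).mul_right _)
  · rw [mul_right_comm] at hzero ⊢
    exact hzero hxxz ((mul_dvd_mul (pow_dvd_pow _ h.1) (hp h.2)).mul_right _)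
  · rw [mul_comm (x ^ i)] at hzero ⊢
    exact hzero hyyx ((mul_dvd_mul (pow_dvd_pow _ h.1) (hp h.2)).mul_right _)
  · rw [mul_assoc] at hzero ⊢
    exact hzero hyyz ((mul_dvd_mul (pow_dvd_pow _ h.1) (hp h.2)).mul_left _)
  · rw [mul_right_comm, mul_comm (x ^ i)] at hzero ⊢
    exact hzero hzzx ((mul_dvd_mul (pow_dvd_pow _ h.1) (hp h.2)).mul_right _)
  · rw [mul_assoc, mul_comm (y ^ j)] at hzero ⊢
    exact hzero hzzy ((mul_dvd_mul (pow_dvd_pow _ h.1) (hp h.2)).mul_left _)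
  · rcases h with ⟨rfl, rfl⟩ | ⟨rfl, rfl⟩ | ⟨rfl, rfl⟩ | ⟨rfl, rfl, rfl⟩ | ⟨rfl, rfl, rfl⟩ |
      ⟨rfl, rfl, rfl⟩ | ⟨rfl, rfl, rfl⟩
    · simpa using hxW le_rfl
    · simpa using hyW le_rfl
    · simpa using hzW le_rfl
    · have := hxW (t := 0 + 1 + 1) (i := P + 2) (by omega)
      simpa [← hyz] using this
    · have := hyW (t := 1 + 0 + 1) (j := Q + 2) (by omega)
      simpa [← hxz] using this
    · have := hzW (t := 1 + 1 + 0) (k := R + 2) (by omega)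
      simpa [← hxy] using this
    · have := hxW (t := 1 + 1 + 1) (i := P + 3) (by omega)
      have h1 : x ^ 1 * y ^ 1 * z ^ 1 = x ^ (P + 3) := by linear_combination x * hyz
      rwa [h1]

open MvPowerSeries in
theorem apolarIdeal_powers_add_XYZ {K : Type*} [Field K] {P Q R : ℕ} (hP : P ≠ 0)
    (hQP : Q ≤ P) (hRP : R ≤ P) {F : MvPolynomial (Fin 3) K}
    (hF : F = MvPolynomial.X 0 ^ (P + 3) + MvPolynomial.X 1 ^ (Q + 3) +
      MvPolynomial.X 2 ^ (R + 3) + MvPolynomial.X 0 * MvPolynomial.X 1 * MvPolynomial.X 2) :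
    apolarIdeal F = Ideal.span {(X 1 * X 2 - X 0 ^ (P + 2) : MvPowerSeries (Fin 3) K),
        X 0 * X 2 - X 1 ^ (Q + 2), X 0 * X 1 - X 2 ^ (R + 2)} ∧
      IsArtinianRing (MvPowerSeries (Fin 3) K ⧸ apolarIdeal F) ∧
      ∀ t, hilbertFunction (apolarIdeal F) t =
        ((axisExponents P Q R).filter fun s => s.degree = t).card := by
  have hcoeff : ∀ i j k, MvPolynomial.coeff (exponent i j k) F =
      if (i = P + 3 ∧ j = 0 ∧ k = 0) ∨ (i = 0 ∧ j = Q + 3 ∧ k = 0) ∨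
        (i = 0 ∧ j = 0 ∧ k = R + 3) ∨ (i = 1 ∧ j = 1 ∧ k = 1) then 1 else 0 := by
    intro i j k
    have : F = MvPolynomial.monomial (exponent (P + 3) 0 0) 1 +
        MvPolynomial.monomial (exponent 0 (Q + 3) 0) 1 +
        MvPolynomial.monomial (exponent 0 0 (R + 3)) 1 +
        MvPolynomial.monomial (exponent 1 1 1) 1 := by
      simp only [MvPolynomial.monomial_exponent, hF]
      simp
    rw [this]
    simp only [MvPolynomial.coeff_add, MvPolynomial.coeff_monomial, exponent_inj]
    split_ifs <;> first | omega | simp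
  -- `d` sends `x ^ i` to the complementary power of `x`, and likewise for `y` and `z`
  refine apolarIdeal_eq_of_monomial_span (S := axisExponents P Q R)
    (d := fun n => if n 1 ≠ 0 then exponent 0 (Q + 3 - n 1) 0 else
      if n 2 ≠ 0 then exponent 0 0 (R + 3 - n 2) else exponent (P + 3 - n 0) 0 0) ?_ ?_
    (monomial_mem_span_axisExponents hP hQP hRP rfl)
  · intro s hs s' hs'
    obtain ⟨i, j, k, rfl⟩ := exists_eq_exponent s
    obtain ⟨i', j', k', rfl⟩ := exists_eq_exponent s'
    rw [exponent_mem_axisExponents] at hs hs'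
    simp only [exponent_zero, exponent_one, exponent_two]
    split_ifs <;> rw [exponent_inj] at * <;>
      simp only [exponent_add, hcoeff] <;> first | rw [if_pos (by omega)] | rw [if_neg (by omega)]
  · rw [Ideal.span_le]
    rintro _ (rfl | rfl | rfl)
    · have := monomial_sub_monomial_mem_apolarIdeal (F := F) (n := exponent 0 1 1)
        (n' := exponent (P + 2) 0 0) fun i j k => by
          simp only [exponent_add, hcoeff]
          exact if_congr (by omega) rfl rfl
      simpa [MvPowerSeries.monomial_exponent] using this
    · have := monomial_sub_monomial_mem_apolarIdeal (F := F) (n := exponent 1 0 1)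
        (n' := exponent 0 (Q + 2) 0) fun i j k => by
          simp only [exponent_add, hcoeff]
          exact if_congr (by omega) rfl rfl
      simpa [MvPowerSeries.monomial_exponent] using this
    · have := monomial_sub_monomial_mem_apolarIdeal (F := F) (n := exponent 1 1 0)
        (n' := exponent 0 0 (R + 2)) fun i j k => by
          simp only [exponent_add, hcoeff]
          exact if_congr (by omega) rfl rfl
      simpa [MvPowerSeries.monomial_exponent] using this

open MvPowerSeries in
theorem isCompleteIntersection_of_relations {K : Type*} [Field K] {P Q R : ℕ} (hP : P ≠ 0)
    (hQP : Q ≤ P) (hRP : R ≤ P) :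
    IsCompleteIntersection (Ideal.span {(X 1 * X 2 - X 0 ^ (P + 2) : MvPowerSeries (Fin 3) K),
      X 0 * X 2 - X 1 ^ (Q + 2), X 0 * X 1 - X 2 ^ (R + 2)}) := by
  refine isCompleteIntersection_of_X_pow_mem (N := P + 4) (by omega) (by omega) (by omega)
    (by omega) ?_
  have h := monomial_mem_span_axisExponents (K := K) hP hQP hRP rfl (exponent (P + 4) 0 0)
  -- no exponent in `axisExponents P Q R` has degree `P + 4`
  have hempty : {s | s ∈ axisExponents P Q R ∧ (exponent (P + 4) 0 0).degree ≤ s.degree} = ∅ := by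
    refine Set.eq_empty_of_forall_notMem fun s hs => ?_
    obtain ⟨i, j, k, rfl⟩ := exists_eq_exponent s
    obtain ⟨h1, h2⟩ := hs
    rw [exponent_mem_axisExponents] at h1
    rw [degree_exponent, degree_exponent] at h2
    omega
  rw [hempty, Set.image_empty, Submodule.span_empty, Submodule.mem_bot,
    Ideal.Quotient.eq_zero_iff_mem] at h
  simpa [MvPowerSeries.monomial_exponent] using h

/-! ### The Artinian complete intersections with Hilbert function `h` -/

theorem theorem3 (K : Type*) [Field K] (u v w : ℕ)
    (x y z : MvPowerSeries (Fin 3) K)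
    (hx : x = MvPowerSeries.X 0) (hy : y = MvPowerSeries.X 1) (hz : z = MvPowerSeries.X 2)
    (X Y Z : MvPolynomial (Fin 3) K)
    (hX : X = MvPolynomial.X 0) (hY : Y = MvPolynomial.X 1) (hZ : Z = MvPolynomial.X 2) :
    (∃ f g p : MvPowerSeries (Fin 3) K,
      IsCompleteIntersection (Ideal.span {f, g, p}) ∧
      IsArtinianRing (MvPowerSeries (Fin 3) K ⧸ Ideal.span {f, g, p}) ∧
      hilbertFunction (Ideal.span {f, g, p}) = hSequence u v w) ∧
    (u = 0 ∧ v = 0 ∧ w = 0 →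
      apolarIdeal (X * Y * Z) = Ideal.span {x ^ 2, y ^ 2, z ^ 2} ∧
      IsCompleteIntersection (apolarIdeal (X * Y * Z)) ∧
      IsArtinianRing (MvPowerSeries (Fin 3) K ⧸ apolarIdeal (X * Y * Z)) ∧
      hilbertFunction (apolarIdeal (X * Y * Z)) = hSequence u v w) ∧
    (u ≠ 0 ∨ v ≠ 0 ∨ w ≠ 0 →
      ∀ F : MvPolynomial (Fin 3) K,
      F = X ^ (u + v + w + 3) + Y ^ (u + v + 3) + Z ^ (u + 3) + X * Y * Z →
      apolarIdeal F = Ideal.span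
        {y * z - x ^ (u + v + w + 2), x * z - y ^ (u + v + 2), x * y - z ^ (u + 2)} ∧
      IsCompleteIntersection (apolarIdeal F) ∧
      IsArtinianRing (MvPowerSeries (Fin 3) K ⧸ apolarIdeal F) ∧
      hilbertFunction (apolarIdeal F) = hSequence u v w) := by
  subst hx hy hz hX hY hZ
  -- the existence statement is a consequence of the two explicit ones
  refine (and_iff_right_of_imp ?_).2 ⟨?_, ?_⟩
  · rintro ⟨h0, h⟩
    by_cases huvw : u = 0 ∧ v = 0 ∧ w = 0
    · obtain ⟨h1, h2⟩ := h0 huvw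
      rw [h1] at h2
      exact ⟨_, _, _, h2⟩
    · obtain ⟨h1, h2⟩ := h (by omega) _ rfl
      rw [h1] at h2
      exact ⟨_, _, _, h2⟩
  · rintro ⟨rfl, rfl, rfl⟩
    obtain ⟨h1, h2, h3⟩ := apolarIdeal_X_mul_Y_mul_Z (K := K) rfl
    exact ⟨h1, h1 ▸ isCompleteIntersection_X_sq, h2, h3⟩
  · intro h F hF
    have hP : u + v + w ≠ 0 := by omega
    have hQP : u + v ≤ u + v + w := by omega
    have hRP : u ≤ u + v + w := by omega
    obtain ⟨h1, h2, h3⟩ := apolarIdeal_powers_add_XYZ hP hQP hRP hF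
    exact ⟨h1, h1 ▸ isCompleteIntersection_of_relations hP hQP hRP, h2,
      funext fun t => (h3 t).trans (card_axisExponents_degree u v w t)⟩
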